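/- Let $0<\alpha<1$, $\bar\alpha=1-\alpha$, and let $X\in\{-1,+1\}$ with $P(X=-1)=\alpha$, $P(X=+1)=\bar\alpha$, be independent of $Z\sim\mathcal N(0,1)$. For $\gamma>0$ let $Y=\sqrt\gamma\,X+Z$ be the output of the binary-input scalar Gaussian channel with signal-to-noise ratio $\gamma$, and let $I(X;Y)$ be the mutual information in bits. Let $H_b(\alpha)=-\alpha\log_2\alpha-\bar\alpha\log_2\bar\alpha$, and for $n\ge 0$ put $$k_n(\alpha)=\frac{\sqrt{2\pi\alpha\bar\alpha}}{8^n\,n!\,\ln 2}\sum_{k=0}^{n}\binom{2n}{2k}\pi^{2(n-k)}\,|E_{2(n-k)}|\sum_{m=0}^{k}2^{2m}\,\frac{(2k)!}{(2k-2m)!}\,\Bigl(\ln\frac{\alpha}{\bar\alpha}\Bigr)^{2(k-m)},$$ where $E_n$ are the Euler numbers, $1/\cosh x=\sum_{n\ge0}E_n x^n/n!$ (so $E_0=1$, $E_2=-1$, $E_4=5$, $E_6=-61$), and $t^0=1$ for every real $t$. Then $I(X;Y)$ is finite for every $\gamma>0$, and as $\gamma\to\infty$ it has the asymptotic expansion $$I(X;Y)\sim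 H_b(\alpha)-\sum_{n=0}^{\infty}\frac{(-1)^n k_n(\alpha)}{\gamma^{n+1/2}}\,e^{-\gamma/2},$$ that is, for every $N\ge0$, $$I(X;Y)-H_b(\alpha)+\sum_{n=0}^{N}\frac{(-1)^n k_n(\alpha)}{\gamma^{n+1/2}}\,e^{-\gamma/2}=o\bigl(\gamma^{-(N+1/2)}e^{-\gamma/2}\bigr)\qquad(\gamma\to\infty).$$ Moreover the partial sums are alternately lower and upper bounds: with $S_N(\gamma)=H_b(\alpha)-\sum_{n=0}^{N-1}(-1)^n k_n(\alpha)\gamma^{-(n+1/2)}e^{-\gamma/2}$, one has $S_{2N+1}(\gamma)\le I(X;Y)\le S_{2N}(\gamma)$ for all $\gamma>0$ and all integers $N\ge0$. -/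

import Mathlib

open MeasureTheory ProbabilityTheory Filter Asymptotics

open scoped ENNReal Nat

noncomputable section

/-- Mutual information `I(X;Y)` of two random variables, in nats: the Kullback–Leibler divergence
of their joint law from the product of their marginal laws. -/
def mutualInfoNats {Ω S T : Type*} [MeasurableSpace Ω] [MeasurableSpace S] [MeasurableSpace T]
    (μ : Measure Ω) (X : Ω → S) (Y : Ω → T) : ℝ≥0∞ :=
  InformationTheory.klDiv (μ.map fun ω => (X ω, Y ω)) ((μ.map X).prod (μ.map Y))

/-- Mutual information in bits, as a real number (meaningful when it is finite). -/
def mutualInfoBits {Ω S T : Type*} [MeasurableSpace Ω] [MeasurableSpace S] [MeasurableSpace T]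
    (μ : Measure Ω) (X : Ω → S) (Y : Ω → T) : ℝ :=
  (mutualInfoNats μ X Y).toReal / Real.log 2

/-- Output `Y = √γ X + Z` of the scalar additive Gaussian channel with signal-to-noise
ratio `γ`. -/
def channelOutput {Ω : Type*} (X Z : Ω → ℝ) (γ : ℝ) : Ω → ℝ :=
  fun ω => √γ * X ω + Z ω

/-- Binary entropy function in bits. -/
def binEntropyBits (p : ℝ) : ℝ :=
  -p * Real.logb 2 p - (1 - p) * Real.logb 2 (1 - p)

/-- The formal power series of `cosh`. -/
def coshSeries : PowerSeries ℚ :=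
  PowerSeries.mk fun n => if Even n then ((n ! : ℕ) : ℚ)⁻¹ else 0

/-- The `n`-th (signed, secant) Euler number: `1 / cosh x = ∑ E_n x ^ n / n!`, so that
`E_0 = 1, E_2 = -1, E_4 = 5, E_6 = -61` and `E_n = 0` for odd `n`. -/
def eulerNumber (n : ℕ) : ℚ :=
  ((n ! : ℕ) : ℚ) * PowerSeries.coeff n coshSeries⁻¹

/-- The coefficient `k_n(α)` of the expansion. -/
def miCoeff (n : ℕ) (α : ℝ) : ℝ :=
  √2 * √(Real.pi * α * (1 - α)) / (8 ^ n * (n ! : ℕ) * Real.log 2) *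
    ∑ k ∈ Finset.range (n + 1),
      ((2 * n).choose (2 * k) : ℝ) * Real.pi ^ (2 * (n - k)) *
        |(eulerNumber (2 * (n - k)) : ℝ)| *
        ∑ m ∈ Finset.range (k + 1),
          2 ^ (2 * m) * ((2 * k).descFactorial (2 * m) : ℝ) *
            Real.log (α / (1 - α)) ^ (2 * (k - m))

/-- The partial sum of the expansion that keeps the `N` terms `n = 0, …, N - 1`. -/
def miPartialSum (α γ : ℝ) (N : ℕ) : ℝ :=
  binEntropyBits α -
    ∑ n ∈ Finset.range N,
      (-1) ^ n * miCoeff n α / γ ^ ((n : ℝ) + 1 / 2) * Real.exp (-γ / 2)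

end

noncomputable section

/-! With `c = log ((1-α)/α) / 2` and `s = √γ`, half the posterior log-likelihood ratio at output `y`
is `u = s y + c`. Written in `u`, the conditional entropy `H(X|Y)` in nats is exactly
`√(α(1-α)/(2πγ)) exp(-γ/2)` times `J(γ) = ∫ exp(-(u-c)²/(2γ)) K(u) du`, where `K(u) = e^u
log(1+e^(-2u)) + e^(-u) log(1+e^(2u))` is nonnegative and exponentially decaying and does not depend
on `α` or `γ`.

The Taylor polynomials of `exp(-t)` lie alternately above and below it for `t ≥ 0`. Integrating them
against `K ≥ 0` gives the two-sided bounds for every `γ > 0`. The asymptotic expansion follows,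
because the error is at most the first omitted term. The coefficients are the even moments of `K`
about `c`.

These moments are computable because `K'' = K - 2/cosh`: integration by parts reduces them to
moments of `1/cosh`. The reflection formula for Gamma gives `∫ e^(tu)/cosh u du = π/cos(πt/2)`,
whose Taylor coefficients are Euler numbers up to sign and powers of `π/2`.

The main links are `sechMoment_even`, `kernelMoment_half_even`,
`alternating_entropyIntegral_sub_sum_nonneg` and `mutualInfoNats_ne_top_and_toReal`. -/

/-! ### Exponential moments of `1 / cosh` -/

lemma hasDerivAt_sigmoid_two_mul (u : ℝ) :
    HasDerivAt (fun u : ℝ => Real.sigmoid (2 * u))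
      (2 * (Real.sigmoid (2 * u) * (1 - Real.sigmoid (2 * u)))) u := by
  have h := (Real.hasDerivAt_sigmoid (2 * u)).comp u ((hasDerivAt_id u).const_mul 2)
  convert! h using 1
  simp; ring

lemma sigmoid_two_mul (u : ℝ) : Real.sigmoid (2 * u) = Real.exp u / (2 * Real.cosh u) := by
  have h : Real.exp (-(2 * u)) = Real.exp (-u) * Real.exp (-u) := by
    rw [← Real.exp_add]; congr 1; ring
  have h' : Real.exp u * Real.exp (-u) = 1 := by rw [← Real.exp_add]; simp
  rw [Real.sigmoid_def, h, Real.cosh_eq, inv_eq_one_div, div_eq_div_iff (by positivity) (by positivity)]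
  linear_combination (- Real.exp (-u)) * h'

lemma one_sub_sigmoid_two_mul (u : ℝ) :
    1 - Real.sigmoid (2 * u) = Real.exp (-u) / (2 * Real.cosh u) := by
  have := Real.cosh_pos u
  rw [sigmoid_two_mul, eq_div_iff (by positivity), sub_mul, div_mul_cancel₀ _ (by positivity),
    Real.cosh_eq]
  ring

lemma range_sigmoid_two_mul :
    (fun u : ℝ => Real.sigmoid (2 * u)) '' Set.univ = Set.Ioo 0 1 := by
  rw [Set.image_univ, ← Real.range_sigmoid]
  exact (mul_left_surjective₀ (two_ne_zero (α := ℝ))).range_comp Real.sigmoid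

lemma beta_half_add {t : ℝ} :
    beta ((1 + t) / 2) ((1 - t) / 2) = Real.pi / Real.cos (Real.pi / 2 * t) := by
  have h1 : (1 + t) / 2 + (1 - t) / 2 = 1 := by ring
  have h2 : (1 - t) / 2 = 1 - (1 + t) / 2 := by ring
  rw [beta, h1, Real.Gamma_one, div_one, h2, Real.Gamma_mul_Gamma_one_sub,
    ← Real.cos_sub_pi_div_two]
  congr 2; ring

lemma cos_pi_div_two_mul_pos {t : ℝ} (h0 : -1 < t) (h1 : t < 1) :
    0 < Real.cos (Real.pi / 2 * t) := by
  have := Real.pi_pos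
  apply Real.cos_pos_of_mem_Ioo
  constructor <;> nlinarith

/-- The substitution `x = sigmoid (2u)` turns the beta density with parameters `(1 ± t)/2` into a
multiple of `e^(tu)/cosh u`: the Jacobian `2x(1-x)` absorbs the two exponents `-1`. Since the beta
density has mass one, the integral is the beta function. Working with `∫⁻` yields integrability at
the same time. -/
lemma lintegral_exp_mul_div_cosh {t : ℝ} (h0 : -1 < t) (h1 : t < 1) :
    ∫⁻ u : ℝ, ENNReal.ofReal (Real.exp (t * u) / Real.cosh u) =
      ENNReal.ofReal (Real.pi / Real.cos (Real.pi / 2 * t)) := by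
  set a := (1 + t) / 2 with ha
  set b := (1 - t) / 2 with hb
  have ha0 : 0 < a := by rw [ha]; linarith
  have hb0 : 0 < b := by rw [hb]; linarith
  have key := lintegral_image_eq_lintegral_abs_deriv_mul (s := Set.univ) MeasurableSet.univ
    (fun u _ => (hasDerivAt_sigmoid_two_mul u).hasDerivWithinAt)
    (fun x _ y _ h => by simpa using Real.sigmoid_injective h) (betaPDF a b)
  rw [range_sigmoid_two_mul, Measure.restrict_univ] at key
  have hI : ∫⁻ x in Set.Ioo 0 1, betaPDF a b x = 1 := by
    rw [← lintegral_betaPDF_eq_one ha0 hb0, lintegral_betaPDF]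
    exact setLIntegral_congr_fun measurableSet_Ioo fun x hx => betaPDF_of_pos_lt_one hx.1 hx.2
  have hB := beta_pos ha0 hb0
  rw [hI] at key
  have hpt (u : ℝ) : ENNReal.ofReal (Real.exp (t * u) / Real.cosh u) = ENNReal.ofReal (beta a b) *
      (ENNReal.ofReal |2 * (Real.sigmoid (2 * u) * (1 - Real.sigmoid (2 * u)))| *
        betaPDF a b (Real.sigmoid (2 * u))) := by
    have hc := Real.cosh_pos u
    have hp := Real.sigmoid_pos (2 * u)
    have hq : 0 < 1 - Real.sigmoid (2 * u) := sub_pos.2 (Real.sigmoid_lt_one _)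
    rw [betaPDF_of_pos_lt_one hp (Real.sigmoid_lt_one _), ← ENNReal.ofReal_mul (abs_nonneg _),
      ← ENNReal.ofReal_mul hB.le, abs_of_pos (by positivity), Real.rpow_sub_one hp.ne',
      Real.rpow_sub_one hq.ne']
    congr 1
    have e : Real.sigmoid (2 * u) ^ a * (1 - Real.sigmoid (2 * u)) ^ b =
        Real.exp (t * u) / (2 * Real.cosh u) := by
      rw [one_sub_sigmoid_two_mul, sigmoid_two_mul, Real.div_rpow (Real.exp_pos _).le (by positivity),
        Real.div_rpow (Real.exp_pos _).le (by positivity), ← Real.exp_mul, ← Real.exp_mul,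
        div_mul_div_comm, ← Real.exp_add, ← Real.rpow_add (by positivity),
        show a + b = 1 by rw [ha, hb]; ring, Real.rpow_one]
      congr 2
      rw [ha, hb]; ring
    have e' : Real.exp (t * u) / Real.cosh u = 2 * (Real.sigmoid (2 * u) ^ a *
        (1 - Real.sigmoid (2 * u)) ^ b) := by
      rw [e]; field_simp
    rw [e']
    field_simp
  simp_rw [hpt]
  rw [lintegral_const_mul' _ _ ENNReal.ofReal_ne_top, ← key, mul_one, ha, hb, beta_half_add]

lemma integrable_exp_mul_div_cosh {t : ℝ} (h0 : -1 < t) (h1 : t < 1) :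
    Integrable fun u : ℝ => Real.exp (t * u) / Real.cosh u := by
  refine ⟨(Continuous.div (by fun_prop) Real.continuous_cosh
    fun u => (Real.cosh_pos u).ne').aestronglyMeasurable, ?_⟩
  rw [hasFiniteIntegral_iff_ofReal (ae_of_all _ fun u =>
    div_nonneg (Real.exp_pos _).le (Real.cosh_pos u).le), lintegral_exp_mul_div_cosh h0 h1]
  exact ENNReal.ofReal_lt_top

lemma integral_exp_mul_div_cosh {t : ℝ} (h0 : -1 < t) (h1 : t < 1) :
    ∫ u : ℝ, Real.exp (t * u) / Real.cosh u = Real.pi / Real.cos (Real.pi / 2 * t) := by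
  rw [integral_eq_lintegral_of_nonneg_ae (ae_of_all _ fun u =>
    div_nonneg (Real.exp_pos _).le (Real.cosh_pos u).le)
    (integrable_exp_mul_div_cosh h0 h1).aestronglyMeasurable, lintegral_exp_mul_div_cosh h0 h1,
    ENNReal.toReal_ofReal (div_nonneg Real.pi_pos.le (cos_pi_div_two_mul_pos h0 h1).le)]

/-! ### Moments of `1 / cosh` and Euler numbers -/

/-- The measure with density `1 / cosh`. -/
def sechMeasure : Measure ℝ :=
  volume.withDensity fun u => ENNReal.ofReal (Real.cosh u)⁻¹

/-- The `n`-th moment of `1 / cosh`. -/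
def sechMoment (n : ℕ) : ℝ := ∫ u : ℝ, u ^ n / Real.cosh u

lemma measurable_ofReal_inv_cosh :
    Measurable fun u : ℝ => ENNReal.ofReal (Real.cosh u)⁻¹ :=
  Real.measurable_cosh.inv.ennreal_ofReal

lemma integral_sechMeasure (f : ℝ → ℝ) : ∫ u, f u ∂sechMeasure = ∫ u, f u / Real.cosh u := by
  rw [sechMeasure, integral_withDensity_eq_integral_toReal_smul measurable_ofReal_inv_cosh
    (ae_of_all _ fun _ => ENNReal.ofReal_lt_top)]
  refine integral_congr_ae (ae_of_all _ fun u => ?_)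
  simp only [smul_eq_mul]
  rw [ENNReal.toReal_ofReal (inv_nonneg.2 (Real.cosh_pos u).le), div_eq_inv_mul]

lemma integrable_sechMeasure_iff (f : ℝ → ℝ) :
    Integrable f sechMeasure ↔ Integrable fun u => f u / Real.cosh u := by
  rw [sechMeasure, integrable_withDensity_iff_integrable_smul' measurable_ofReal_inv_cosh
    (ae_of_all _ fun _ => ENNReal.ofReal_lt_top)]
  refine integrable_congr (ae_of_all _ fun u => ?_)
  simp only [smul_eq_mul]
  rw [ENNReal.toReal_ofReal (inv_nonneg.2 (Real.cosh_pos u).le), div_eq_inv_mul]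

lemma zero_mem_interior_integrableExpSet_sechMeasure :
    (0 : ℝ) ∈ interior (integrableExpSet id sechMeasure) := by
  refine mem_interior.2 ⟨Set.Ioo (-1) 1, fun t ht => ?_, isOpen_Ioo, by norm_num⟩
  exact (integrable_sechMeasure_iff _).2 (integrable_exp_mul_div_cosh ht.1 ht.2)

lemma cos_mul_mgf_sechMeasure_eventuallyEq :
    (fun t => Real.cos (Real.pi / 2 * t) * mgf id sechMeasure t) =ᶠ[nhds 0] fun _ => Real.pi := by
  filter_upwards [isOpen_Ioo.mem_nhds (show (0 : ℝ) ∈ Set.Ioo (-1) 1 by norm_num)] with t ht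
  rw [mgf, integral_sechMeasure]
  simp only [id]
  rw [integral_exp_mul_div_cosh ht.1 ht.2,
    mul_div_cancel₀ _ (cos_pi_div_two_mul_pos ht.1 ht.2).ne']

/-- Leibniz's rule at `0` for the product of `cos (πt/2)` and the moment generating function of
`sechMeasure`, which is constantly `π` near `0`. -/
lemma sum_iteratedDeriv_cos_mul_sechMoment (n : ℕ) :
    ∑ i ∈ Finset.range (n + 1), n.choose i * ((Real.pi / 2) ^ i * iteratedDeriv i Real.cos 0) *
      sechMoment (n - i) = if n = 0 then Real.pi else 0 := by
  have h0 := zero_mem_interior_integrableExpSet_sechMeasure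
  have h := cos_mul_mgf_sechMeasure_eventuallyEq.iteratedDeriv_eq n
  rw [iteratedDeriv_const, iteratedDeriv_fun_mul (by fun_prop) (analyticAt_mgf h0).contDiffAt] at h
  rw [← h]
  refine Finset.sum_congr rfl fun i _ => ?_
  rw [iteratedDeriv_comp_const_mul Real.contDiff_cos, iteratedDeriv_mgf_zero h0,
    integral_sechMeasure]
  simp only [mul_zero]
  rfl

lemma iteratedDeriv_cos_zero (i : ℕ) :
    ((iteratedDeriv i Real.cos 0 : ℝ) : ℂ) =
      Complex.I ^ i * ((i ! : ℕ) * (PowerSeries.coeff i coshSeries : ℚ)) := by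
  rw [coshSeries, PowerSeries.coeff_mk]
  rcases Nat.even_or_odd' i with ⟨k, rfl | rfl⟩
  · rw [Real.iteratedDeriv_even_cos, if_pos (even_two_mul k), pow_mul, Complex.I_sq]
    have : (((2 * k)! : ℕ) : ℂ) ≠ 0 := by exact_mod_cast Nat.factorial_ne_zero _
    push_cast
    simp [this]
  · rw [Real.iteratedDeriv_odd_cos, if_neg (by simp)]
    simp

/-- The recursion for the moments, read as one identity of generating functions. Passing to `ℂ` lets
`cos x = cosh (i x)` become a rescaling, so that inverting `coshSeries` then produces the Euler
numbers. -/
lemma rescale_coshSeries_mul_sechMoment :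
    PowerSeries.rescale (Complex.I * (Real.pi / 2)) (coshSeries.map (algebraMap ℚ ℂ)) *
      PowerSeries.mk (fun n => ((sechMoment n / n ! : ℝ) : ℂ)) = PowerSeries.C (Real.pi : ℂ) := by
  ext n
  rw [PowerSeries.coeff_mul, PowerSeries.coeff_C]
  have h := congrArg (fun x : ℝ => ((x / n ! : ℝ) : ℂ)) (sum_iteratedDeriv_cos_mul_sechMoment n)
  have hr : (((if n = 0 then Real.pi else 0) / n ! : ℝ) : ℂ) = if n = 0 then (Real.pi : ℂ) else 0 := by
    split_ifs with hn <;> simp [hn]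
  simp only [hr] at h
  rw [← h, Finset.Nat.sum_antidiagonal_eq_sum_range_succ_mk, Finset.sum_div]
  push_cast
  refine Finset.sum_congr rfl fun i hi => ?_
  have hi' : i ≤ n := Nat.lt_succ_iff.1 (Finset.mem_range.1 hi)
  rw [iteratedDeriv_cos_zero, PowerSeries.coeff_rescale, PowerSeries.coeff_map,
    PowerSeries.coeff_mk, Nat.cast_choose ℂ hi', mul_pow]
  have h1 : ((n ! : ℕ) : ℂ) ≠ 0 := by exact_mod_cast Nat.factorial_ne_zero _
  have h2 : ((i ! : ℕ) : ℂ) ≠ 0 := by exact_mod_cast Nat.factorial_ne_zero _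
  have h3 : (((n - i)! : ℕ) : ℂ) ≠ 0 := by exact_mod_cast Nat.factorial_ne_zero _
  simp only [eq_ratCast]
  field_simp

lemma coshSeries_mul_inv : coshSeries * coshSeries⁻¹ = 1 := by
  apply PowerSeries.mul_inv_cancel
  rw [← PowerSeries.coeff_zero_eq_constantCoeff_apply, coshSeries, PowerSeries.coeff_mk]
  simp

lemma sechMoment_eq_eulerNumber (n : ℕ) :
    (sechMoment n : ℂ) = Real.pi * (Complex.I * (Real.pi / 2)) ^ n * (eulerNumber n : ℚ) := by
  have h := congrArg (fun f => PowerSeries.rescale (Complex.I * (Real.pi / 2))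
    (PowerSeries.map (algebraMap ℚ ℂ) f)) coshSeries_mul_inv
  simp only [map_mul, map_one] at h
  set A := PowerSeries.rescale (Complex.I * (Real.pi / 2)) (coshSeries.map (algebraMap ℚ ℂ))
  set B := PowerSeries.rescale (Complex.I * (Real.pi / 2)) (coshSeries⁻¹.map (algebraMap ℚ ℂ)) with hB
  have h2 := rescale_coshSeries_mul_sechMoment
  set M := PowerSeries.mk (fun n => ((sechMoment n / n ! : ℝ) : ℂ)) with hM
  have h3 : M = PowerSeries.C (Real.pi : ℂ) * B := by
    linear_combination B * h2 - M * h
  have h4 := congrArg (PowerSeries.coeff n) h3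
  rw [PowerSeries.coeff_C_mul, hM, hB, PowerSeries.coeff_mk, PowerSeries.coeff_rescale,
    PowerSeries.coeff_map] at h4
  have h1 : ((n ! : ℕ) : ℂ) ≠ 0 := by exact_mod_cast Nat.factorial_ne_zero _
  rw [eulerNumber]
  push_cast at h4 ⊢
  rw [div_eq_iff h1] at h4
  rw [h4, eq_ratCast]
  ring

lemma sechMoment_nonneg_of_even {n : ℕ} (hn : Even n) : 0 ≤ sechMoment n :=
  integral_nonneg fun u => div_nonneg (hn.pow_nonneg u) (Real.cosh_pos u).le

/-- The even moments of `1 / cosh` are given by the Euler numbers. -/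
lemma sechMoment_even (j : ℕ) :
    sechMoment (2 * j) = Real.pi * (Real.pi / 2) ^ (2 * j) * |(eulerNumber (2 * j) : ℝ)| := by
  have h := congrArg norm (sechMoment_eq_eulerNumber (2 * j))
  rw [Complex.norm_real, Real.norm_of_nonneg (sechMoment_nonneg_of_even (even_two_mul j))] at h
  rw [h]
  simp [abs_of_pos Real.pi_pos]

lemma sechMoment_odd (j : ℕ) : sechMoment (2 * j + 1) = 0 := by
  have h := integral_neg_eq_self (fun u : ℝ => u ^ (2 * j + 1) / Real.cosh u) volume
  simp only [Real.cosh_neg, (odd_two_mul_add_one j).neg_pow, neg_div, integral_neg] at h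
  change - sechMoment _ = sechMoment _ at h
  linarith

/-! ### The entropy kernel and its decay -/

/-- The function `u ↦ exp u * log (1 + exp (-2u))`. -/
def expMulLog (u : ℝ) : ℝ := Real.exp u * Real.log (1 + Real.exp (-2 * u))

/-- The even, exponentially decaying kernel through which the conditional entropy of a binary
input is an integral. -/
def entropyKernel (u : ℝ) : ℝ := expMulLog u + expMulLog (-u)

/-- An envelope with exponential decay. -/
def decayEnvelope (u : ℝ) : ℝ := (Real.exp (u / 2) + Real.exp (-(u / 2))) / Real.cosh u

lemma decayEnvelope_neg (u : ℝ) : decayEnvelope (-u) = decayEnvelope u := by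
  rw [decayEnvelope, decayEnvelope, Real.cosh_neg, neg_div, neg_neg, add_comm]

lemma continuous_expMulLog : Continuous expMulLog :=
  Real.continuous_exp.mul (Continuous.log (by fun_prop) fun u => by positivity)

lemma continuous_entropyKernel : Continuous entropyKernel :=
  continuous_expMulLog.add (continuous_expMulLog.comp continuous_neg)

lemma expMulLog_nonneg (u : ℝ) : 0 ≤ expMulLog u :=
  mul_nonneg (Real.exp_pos u).le (Real.log_nonneg (by linarith [Real.exp_pos (-2 * u)]))

lemma entropyKernel_nonneg (u : ℝ) : 0 ≤ entropyKernel u :=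
  add_nonneg (expMulLog_nonneg u) (expMulLog_nonneg (-u))

lemma two_le_exp_half_add (u : ℝ) : 2 ≤ Real.exp (u / 2) + Real.exp (-(u / 2)) := by
  have := Real.one_le_cosh (u / 2)
  rw [Real.cosh_eq] at this
  linarith

lemma inv_cosh_le_decayEnvelope (u : ℝ) : (Real.cosh u)⁻¹ ≤ decayEnvelope u := by
  rw [decayEnvelope, inv_eq_one_div]
  have := two_le_exp_half_add u
  have := Real.cosh_pos u
  gcongr
  linarith

lemma log_one_add_exp_neg_le (u : ℝ) :
    Real.log (1 + Real.exp (-2 * u)) ≤ 4 * Real.exp (-(u / 2)) := by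
  -- With `x = exp (-u/2)` this is `1 + x^4 ≤ (1 + x)^4`.
  have h : 1 + Real.exp (-2 * u) ≤ (1 + Real.exp (-(u / 2))) ^ 4 := by
    have e : Real.exp (-2 * u) = Real.exp (-(u / 2)) ^ 4 := by
      rw [← Real.exp_nat_mul]; congr 1; push_cast; ring
    rw [e]
    have := Real.exp_pos (-(u / 2))
    set x := Real.exp (-(u / 2))
    have : 0 ≤ 4 * x + 6 * x ^ 2 + 4 * x ^ 3 := by positivity
    linarith [show (1 + x) ^ 4 = 1 + (4 * x + 6 * x ^ 2 + 4 * x ^ 3) + x ^ 4 by ring]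
  calc Real.log (1 + Real.exp (-2 * u)) ≤ Real.log ((1 + Real.exp (-(u / 2))) ^ 4) :=
        Real.log_le_log (by positivity) h
    _ = 4 * Real.log (1 + Real.exp (-(u / 2))) := by rw [Real.log_pow]; norm_num
    _ ≤ 4 * Real.exp (-(u / 2)) := by
        have := Real.log_le_sub_one_of_pos (show 0 < 1 + Real.exp (-(u / 2)) by positivity)
        linarith

/-- Multiplication by `cosh u` splits the left side into `e^(2u)/2` and `1/2` times the logarithm.
The first is bounded by `log (1 + x) ≤ x`, the second by `log_one_add_exp_neg_le`. -/
lemma expMulLog_le (u : ℝ) : expMulLog u ≤ 3 * decayEnvelope u := by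
  rw [decayEnvelope, mul_div_assoc', le_div_iff₀ (Real.cosh_pos u), Real.cosh_eq, expMulLog]
  have h1 := log_one_add_exp_neg_le u
  have h2 := Real.log_le_sub_one_of_pos (show 0 < 1 + Real.exp (-2 * u) by positivity)
  have e1 : Real.exp u * Real.exp (-u) = 1 := by rw [← Real.exp_add]; simp
  have e2 : Real.exp u ^ 2 * Real.exp (-2 * u) = 1 := by
    rw [← Real.exp_nat_mul, ← Real.exp_add]; simp
  have h3 := mul_le_mul_of_nonneg_left h2 (sq_nonneg (Real.exp u))
  have h4 := two_le_exp_half_add u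
  have h5 := Real.exp_pos (u / 2)
  have e3 : Real.exp u * Real.log (1 + Real.exp (-2 * u)) * ((Real.exp u + Real.exp (-u)) / 2) =
      (Real.exp u ^ 2 * Real.log (1 + Real.exp (-2 * u)) + Real.log (1 + Real.exp (-2 * u))) / 2 := by
    linear_combination (Real.log (1 + Real.exp (-2 * u)) / 2) * e1
  rw [e3]
  linarith

lemma abs_entropyKernel_le (u : ℝ) : |entropyKernel u| ≤ 6 * decayEnvelope u := by
  rw [abs_of_nonneg (entropyKernel_nonneg u), entropyKernel]
  have h := expMulLog_le (-u)
  rw [decayEnvelope_neg] at h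
  linarith [expMulLog_le u]

lemma abs_expMulLog_sub_le (u : ℝ) :
    |expMulLog u - expMulLog (-u)| ≤ 6 * decayEnvelope u := by
  refine (abs_sub _ _).trans ?_
  rw [abs_of_nonneg (expMulLog_nonneg u), abs_of_nonneg (expMulLog_nonneg (-u))]
  have h := expMulLog_le (-u)
  rw [decayEnvelope_neg] at h
  linarith [expMulLog_le u]

lemma integrable_abs_pow_mul_decayEnvelope (c : ℝ) (n : ℕ) :
    Integrable fun u : ℝ => |u - c| ^ n * decayEnvelope u := by
  have hexp {t : ℝ} (h0 : -1 < t) (h1 : t < 1) :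
      Integrable (fun u : ℝ => Real.exp (t * (u - c))) sechMeasure := by
    rw [integrable_sechMeasure_iff]
    refine ((integrable_exp_mul_div_cosh h0 h1).const_mul (Real.exp (-(t * c)))).congr
      (ae_of_all _ fun u => ?_)
    change Real.exp (-(t * c)) * (Real.exp (t * u) / _) = _
    rw [mul_div_assoc', ← Real.exp_add]
    congr 2; ring
  -- The power of `|u - c|` costs a margin `1/4` in the exponent, and `v ± 1/4` must stay in `(-1,
  -- 1)`. The envelope needs only `v = ± 1/2`.
  have hmul {v : ℝ} (h0 : -3 / 4 < v) (h1 : v < 3 / 4) :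
      Integrable fun u : ℝ => |u - c| ^ n * Real.exp (v * (u - c)) / Real.cosh u := by
    rw [← integrable_sechMeasure_iff]
    exact integrable_pow_abs_mul_exp_of_integrable_exp_mul (t := 1 / 4) (by norm_num)
      (hexp (by linarith) (by linarith)) (hexp (by linarith) (by linarith)) n
  have h1 := (hmul (v := 1 / 2) (by norm_num) (by norm_num)).const_mul (Real.exp (c / 2))
  have h2 := (hmul (v := -1 / 2) (by norm_num) (by norm_num)).const_mul (Real.exp (-(c / 2)))
  refine (h1.add h2).congr (ae_of_all _ fun u => ?_)
  have e1 : Real.exp (u / 2) = Real.exp (c / 2) * Real.exp (1 / 2 * (u - c)) := by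
    rw [← Real.exp_add]; congr 1; ring
  have e2 : Real.exp (-(u / 2)) = Real.exp (-(c / 2)) * Real.exp (-1 / 2 * (u - c)) := by
    rw [← Real.exp_add]; congr 1; ring
  simp only [Pi.add_apply, decayEnvelope, e1, e2]
  ring

lemma integrable_pow_mul_of_le_decayEnvelope {f : ℝ → ℝ} {K : ℝ} (hf : Continuous f)
    (hK : ∀ u, |f u| ≤ K * decayEnvelope u) (c : ℝ) (n : ℕ) :
    Integrable fun u : ℝ => (u - c) ^ n * f u := by
  refine ((integrable_abs_pow_mul_decayEnvelope c n).const_mul K).mono'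
    (by fun_prop : Continuous fun u : ℝ => (u - c) ^ n * f u).aestronglyMeasurable
    (ae_of_all _ fun u => ?_)
  rw [norm_mul, norm_pow, Real.norm_eq_abs, Real.norm_eq_abs]
  calc |u - c| ^ n * |f u| ≤ |u - c| ^ n * (K * decayEnvelope u) := by gcongr; exact hK u
    _ = _ := by ring

/-! ### Moments of the entropy kernel by integration by parts -/

/-- Integrability of all the products makes the boundary terms vanish. At `n = 0` the truncated `n -
1` is harmless because of the factor `n`. -/
lemma integral_pow_mul_deriv {f f' : ℝ → ℝ} {K K' : ℝ} (hff' : ∀ u, HasDerivAt f (f' u) u)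
    (hf' : Continuous f') (hK : ∀ u, |f u| ≤ K * decayEnvelope u)
    (hK' : ∀ u, |f' u| ≤ K' * decayEnvelope u) (c : ℝ) (n : ℕ) :
    ∫ u : ℝ, (u - c) ^ n * f' u = -(n * ∫ u : ℝ, (u - c) ^ (n - 1) * f u) := by
  have hf : Continuous f := continuous_iff_continuousAt.2 fun u => (hff' u).continuousAt
  have h := integral_mul_deriv_eq_deriv_mul_of_integrable
    (u := fun u : ℝ => (u - c) ^ n) (u' := fun u => n * (u - c) ^ (n - 1)) (v := f) (v' := f')
    (fun u _ => by simpa using ((hasDerivAt_id u).sub_const c).fun_pow n) (fun u _ => hff' u)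
    (integrable_pow_mul_of_le_decayEnvelope hf' hK' c n)
    (((integrable_pow_mul_of_le_decayEnvelope hf hK c (n - 1)).const_mul (n : ℝ)).congr
      (ae_of_all _ fun u => by simp [mul_assoc]))
    (integrable_pow_mul_of_le_decayEnvelope hf hK c n)
  rw [h, ← integral_const_mul]
  simp only [mul_assoc]

lemma hasDerivAt_expMulLog (u : ℝ) :
    HasDerivAt expMulLog (expMulLog u - (Real.cosh u)⁻¹) u := by
  have h1 : HasDerivAt (fun u : ℝ => 1 + Real.exp (-2 * u)) (Real.exp (-2 * u) * (-2)) u := by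
    simpa using (((hasDerivAt_id u).const_mul (-2)).exp.const_add 1)
  have h2 := (Real.hasDerivAt_exp u).mul (h1.log (by positivity))
  convert! h2 using 1
  rw [expMulLog, sub_eq_add_neg]
  congr 1
  have e1 : Real.exp u * Real.exp (-u) = 1 := by rw [← Real.exp_add]; simp
  have e2 : Real.exp (-2 * u) = Real.exp (-u) * Real.exp (-u) := by
    rw [← Real.exp_add]; congr 1; ring
  rw [e2, Real.cosh_eq, inv_div]
  have := Real.exp_pos u
  have := Real.exp_pos (-u)
  rw [mul_div_assoc', ← neg_div, div_eq_div_iff (by positivity) (by positivity)]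
  linear_combination (2 * Real.exp u * Real.exp (-u) + 2 + 2 * Real.exp (-u) ^ 2) * e1

lemma hasDerivAt_expMulLog_neg (u : ℝ) :
    HasDerivAt (fun u => expMulLog (-u)) (-expMulLog (-u) + (Real.cosh u)⁻¹) u := by
  have h := (hasDerivAt_expMulLog (-u)).comp u (hasDerivAt_neg u)
  convert! h using 1
  rw [Real.cosh_neg]; ring

lemma hasDerivAt_entropyKernel (u : ℝ) :
    HasDerivAt entropyKernel (expMulLog u - expMulLog (-u)) u := by
  convert! (hasDerivAt_expMulLog u).add (hasDerivAt_expMulLog_neg u) using 1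
  ring

lemma hasDerivAt_expMulLog_sub (u : ℝ) :
    HasDerivAt (fun u => expMulLog u - expMulLog (-u))
      (entropyKernel u - 2 * (Real.cosh u)⁻¹) u := by
  convert! (hasDerivAt_expMulLog u).sub (hasDerivAt_expMulLog_neg u) using 1
  rw [entropyKernel]; ring

/-- Moments of the entropy kernel about `c`. -/
def kernelMoment (c : ℝ) (n : ℕ) : ℝ := ∫ u : ℝ, (u - c) ^ n * entropyKernel u

/-- Moments of `1 / cosh` about `c`. -/
def sechMomentAbout (c : ℝ) (n : ℕ) : ℝ := ∫ u : ℝ, (u - c) ^ n * (Real.cosh u)⁻¹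

lemma continuous_inv_cosh : Continuous fun u : ℝ => (Real.cosh u)⁻¹ :=
  Real.continuous_cosh.inv₀ fun u => (Real.cosh_pos u).ne'

lemma abs_inv_cosh_le (u : ℝ) : |(Real.cosh u)⁻¹| ≤ 1 * decayEnvelope u := by
  rw [abs_of_nonneg (inv_nonneg.2 (Real.cosh_pos u).le), one_mul]
  exact inv_cosh_le_decayEnvelope u

lemma integrable_pow_mul_entropyKernel (c : ℝ) (n : ℕ) :
    Integrable fun u : ℝ => (u - c) ^ n * entropyKernel u :=
  integrable_pow_mul_of_le_decayEnvelope continuous_entropyKernel abs_entropyKernel_le c n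

lemma integrable_pow_mul_inv_cosh (c : ℝ) (n : ℕ) :
    Integrable fun u : ℝ => (u - c) ^ n * (Real.cosh u)⁻¹ :=
  integrable_pow_mul_of_le_decayEnvelope continuous_inv_cosh abs_inv_cosh_le c n

/-- Two integrations by parts applied to `K'' = K - 2/cosh`. For `n = 0, 1` the truncated index is
multiplied by zero. -/
lemma kernelMoment_eq (c : ℝ) (n : ℕ) :
    kernelMoment c n =
      2 * sechMomentAbout c n + n * ((n - 1 : ℕ) * kernelMoment c (n - 1 - 1)) := by
  have hA : Continuous fun u => expMulLog u - expMulLog (-u) :=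
    continuous_expMulLog.sub (continuous_expMulLog.comp continuous_neg)
  have hB (u : ℝ) : |entropyKernel u - 2 * (Real.cosh u)⁻¹| ≤ 8 * decayEnvelope u := by
    refine (abs_sub _ _).trans ?_
    rw [abs_mul, abs_two]
    linarith [abs_entropyKernel_le u, abs_inv_cosh_le u]
  have h1 := integral_pow_mul_deriv hasDerivAt_expMulLog_sub
    (continuous_entropyKernel.sub (continuous_inv_cosh.const_mul 2)) abs_expMulLog_sub_le hB c n
  have h2 := integral_pow_mul_deriv hasDerivAt_entropyKernel hA abs_entropyKernel_le
    abs_expMulLog_sub_le c (n - 1)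
  rw [h2] at h1
  have h3 : ∫ u : ℝ, (u - c) ^ n * (entropyKernel u - 2 * (Real.cosh u)⁻¹) =
      kernelMoment c n - 2 * sechMomentAbout c n := by
    rw [kernelMoment, sechMomentAbout, ← integral_const_mul, ← integral_sub
      (integrable_pow_mul_entropyKernel c n) ((integrable_pow_mul_inv_cosh c n).const_mul 2)]
    congr 1; ext u; ring
  rw [h3] at h1
  simp only [kernelMoment] at h1 ⊢
  linarith

lemma kernelMoment_even (c : ℝ) (n : ℕ) :
    kernelMoment c (2 * n) = 2 * ∑ m ∈ Finset.range (n + 1),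
      ((2 * n).descFactorial (2 * m) : ℝ) * sechMomentAbout c (2 * (n - m)) := by
  induction n with
  | zero => rw [kernelMoment_eq]; simp
  | succ n ih =>
    rw [kernelMoment_eq, Finset.sum_range_succ', show 2 * (n + 1) - 1 - 1 = 2 * n by omega, ih,
      mul_add (2 : ℝ), add_comm (2 * sechMomentAbout _ _)]
    congr 1
    · simp only [Finset.mul_sum]
      refine Finset.sum_congr rfl fun m _ => ?_
      rw [show 2 * (n + 1) - 1 = 2 * n + 1 by omega, show n + 1 - (m + 1) = n - m by omega,
        show 2 * (n + 1) = (2 * n + 1) + 1 by ring, show 2 * (m + 1) = (2 * m + 1) + 1 by ring,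
        Nat.succ_descFactorial_succ, Nat.succ_descFactorial_succ]
      push_cast
      ring
    · simp

lemma sum_range_two_mul_add_one_of_odd_zero {f : ℕ → ℝ} (hf : ∀ j, f (2 * j + 1) = 0) (n : ℕ) :
    ∑ i ∈ Finset.range (2 * n + 1), f i = ∑ j ∈ Finset.range (n + 1), f (2 * j) := by
  induction n with
  | zero => simp
  | succ n ih =>
    rw [show 2 * (n + 1) + 1 = 2 * n + 1 + 1 + 1 by ring, Finset.sum_range_succ,
      Finset.sum_range_succ, ih, hf, Finset.sum_range_succ _ (n + 1)]
    simp [mul_add]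

lemma sechMomentAbout_even (c : ℝ) (n : ℕ) :
    sechMomentAbout c (2 * n) = ∑ j ∈ Finset.range (n + 1),
      ((2 * n).choose (2 * j) : ℝ) * sechMoment (2 * j) * c ^ (2 * (n - j)) := by
  have h (u : ℝ) : (u - c) ^ (2 * n) * (Real.cosh u)⁻¹ = ∑ i ∈ Finset.range (2 * n + 1),
      ((-c) ^ (2 * n - i) * ((2 * n).choose i : ℝ)) * ((u - 0) ^ i * (Real.cosh u)⁻¹) := by
    rw [sub_eq_add_neg, add_pow, Finset.sum_mul]
    refine Finset.sum_congr rfl fun i _ => ?_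
    rw [sub_zero]; ring
  simp only [sechMomentAbout, h]
  rw [integral_finsetSum _ fun i _ => (integrable_pow_mul_inv_cosh 0 i).const_mul _]
  have h' (i : ℕ) : ∫ u : ℝ, ((-c) ^ (2 * n - i) * ((2 * n).choose i : ℝ)) *
      ((u - 0) ^ i * (Real.cosh u)⁻¹) =
      ((-c) ^ (2 * n - i) * ((2 * n).choose i : ℝ)) * sechMoment i := by
    rw [integral_const_mul, sechMoment]
    simp only [sub_zero, div_eq_mul_inv]
  simp only [h']
  rw [sum_range_two_mul_add_one_of_odd_zero fun j => by rw [sechMoment_odd, mul_zero]]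
  refine Finset.sum_congr rfl fun j _ => ?_
  rw [← Nat.mul_sub, Even.neg_pow (even_two_mul _)]
  ring

/-- Both sides equal `(a+b+r)! / (b! r!)`. This matches the coefficients after the order of
summation is exchanged in `kernelMoment_half_even`. -/
lemma descFactorial_mul_choose_add (a b r : ℕ) :
    (a + b + r).descFactorial a * (b + r).choose b =
      (a + b + r).choose (a + r) * (a + r).descFactorial a := by
  have h1 : r ! * (a + r).descFactorial a = (a + r)! := by
    simpa using Nat.factorial_mul_descFactorial (Nat.le_add_right a r)
  have h2 : (b + r)! * (a + b + r).descFactorial a = (a + b + r)! := by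
    have := Nat.factorial_mul_descFactorial (show a ≤ a + b + r by omega)
    rwa [show a + b + r - a = b + r by omega] at this
  have h3 : (b + r).choose b * b ! * r ! = (b + r)! := by
    simpa using Nat.choose_mul_factorial_mul_factorial (Nat.le_add_right b r)
  have h4 : (a + b + r).choose (a + r) * (a + r)! * b ! = (a + b + r)! := by
    have := Nat.choose_mul_factorial_mul_factorial (show a + r ≤ a + b + r by omega)
    rwa [show a + b + r - (a + r) = b by omega] at this
  refine Nat.eq_of_mul_eq_mul_left (Nat.mul_pos (Nat.factorial_pos b) (Nat.factorial_pos r)) ?_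
  calc b ! * r ! * ((a + b + r).descFactorial a * (b + r).choose b)
      = ((b + r).choose b * b ! * r !) * (a + b + r).descFactorial a := by ring
    _ = (a + b + r).choose (a + r) * (r ! * (a + r).descFactorial a) * b ! := by rw [h3, h2, h1, h4]
    _ = _ := by ring

/-- The even moments of the entropy kernel about `L / 2` in terms of the Euler numbers. -/
lemma kernelMoment_half_even (L : ℝ) (n : ℕ) :
    kernelMoment (L / 2) (2 * n) = 2 * Real.pi / 4 ^ n * ∑ k ∈ Finset.range (n + 1),
      ((2 * n).choose (2 * k) : ℝ) * Real.pi ^ (2 * (n - k)) *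
        |(eulerNumber (2 * (n - k)) : ℝ)| *
        ∑ m ∈ Finset.range (k + 1),
          2 ^ (2 * m) * ((2 * k).descFactorial (2 * m) : ℝ) * L ^ (2 * (k - m)) := by
  rw [kernelMoment_even]
  -- Reversing `k ↦ n - k` makes the Euler index the outer variable; the triangular double sum is
  -- then exchanged and compared termwise.
  conv_rhs => rw [← Finset.sum_flip]
  simp only [sechMomentAbout_even, Finset.mul_sum]
  conv_rhs => rw [Finset.sum_comm' (t' := Finset.range (n + 1)) (s' := fun m => Finset.range (n - m + 1))
    (fun j m => by simp only [Finset.mem_range]; omega)]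
  refine Finset.sum_congr rfl fun m hm => Finset.sum_congr rfl fun j hj => ?_
  rw [Finset.mem_range] at hm hj
  obtain ⟨r, rfl⟩ : ∃ r, n = m + j + r := ⟨n - m - j, by omega⟩
  have h := descFactorial_mul_choose_add (2 * m) (2 * j) (2 * r)
  have h' : ((2 * (m + j + r)).descFactorial (2 * m) : ℝ) * ((2 * (j + r)).choose (2 * j) : ℝ) =
      ((2 * (m + j + r)).choose (2 * (m + r)) : ℝ) * ((2 * (m + r)).descFactorial (2 * m) : ℝ) := by
    simp only [← mul_add] at h
    exact_mod_cast h
  rw [sechMoment_even, show m + j + r - m = j + r by omega, show j + r - j = r by omega,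
    show m + j + r - j = m + r by omega, show m + j + r - (m + r) = j by omega,
    show m + r - m = r by omega]
  have e4 : (4 : ℝ) ^ (m + j + r) = 2 ^ (2 * m) * 2 ^ (2 * j) * 2 ^ (2 * r) := by
    rw [← pow_add, ← pow_add, ← mul_add, ← mul_add, pow_mul]; norm_num
  rw [e4, div_pow, div_pow]
  field_simp
  linear_combination (|(eulerNumber (2 * j) : ℝ)| * L ^ (2 * r)) * h'

/-! ### Alternating Taylor bounds for the entropy integral -/

lemma hasDerivAt_sum_neg_pow_div_factorial (N : ℕ) (t : ℝ) :
    HasDerivAt (fun t : ℝ => ∑ n ∈ Finset.range (N + 1), (-t) ^ n / n !)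
      (-∑ n ∈ Finset.range N, (-t) ^ n / n !) t := by
  have h (n : ℕ) : HasDerivAt (fun t : ℝ => (-t) ^ (n + 1) / (n + 1)!) (-((-t) ^ n / n !)) t := by
    convert! ((hasDerivAt_neg t).fun_pow (n + 1)).div_const ((n + 1)! : ℝ) using 1
    rw [Nat.factorial_succ]
    push_cast
    have : (n ! : ℝ) ≠ 0 := by exact_mod_cast Nat.factorial_ne_zero _
    field_simp
  simp only [Finset.sum_range_succ', ← Finset.sum_neg_distrib]
  simpa using (HasDerivAt.fun_sum fun n (_ : n ∈ Finset.range N) => h n).add_const (1 : ℝ)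

/-- The Taylor polynomials of `exp (-t)` are alternately above and below it for `t ≥ 0`. -/
lemma alternating_exp_neg_sub_sum_nonneg (N : ℕ) {t : ℝ} (ht : 0 ≤ t) :
    0 ≤ (-1) ^ N * (Real.exp (-t) - ∑ n ∈ Finset.range N, (-t) ^ n / n !) := by
  induction N generalizing t with
  | zero => simpa using (Real.exp_pos _).le
  | succ N ih =>
    -- The signed remainder of order `N + 1` has the one of order `N` as derivative, so it increases
    -- on `t ≥ 0` from its value `0` at `t = 0`.
    have hd (t : ℝ) : HasDerivAt (fun t : ℝ => (-1) ^ (N + 1) *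
        (Real.exp (-t) - ∑ n ∈ Finset.range (N + 1), (-t) ^ n / n !))
        ((-1) ^ N * (Real.exp (-t) - ∑ n ∈ Finset.range N, (-t) ^ n / n !)) t := by
      convert! ((hasDerivAt_neg t).exp.sub
        (hasDerivAt_sum_neg_pow_div_factorial N t)).const_mul ((-1 : ℝ) ^ (N + 1)) using 1
      rw [pow_succ]; ring
    have hm := monotoneOn_of_deriv_nonneg (convex_Ici (0 : ℝ))
      (fun t _ => (hd t).continuousAt.continuousWithinAt)
      (fun t _ => (hd t).differentiableAt.differentiableWithinAt)
      (fun t h => by rw [(hd t).deriv]; exact ih (interior_subset h))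
    have := hm Set.self_mem_Ici ht ht
    simpa [Finset.sum_range_succ'] using this

/-- The integral of the entropy kernel against a Gaussian of variance `γ` centred at `c`. -/
def entropyIntegral (c γ : ℝ) : ℝ :=
  ∫ u : ℝ, Real.exp (-((u - c) ^ 2 / (2 * γ))) * entropyKernel u

lemma integrable_exp_mul_of_le_decayEnvelope {f : ℝ → ℝ} {K : ℝ} (hf : Continuous f)
    (hK : ∀ u, |f u| ≤ K * decayEnvelope u) (c : ℝ) {γ : ℝ} (hγ : 0 < γ) :
    Integrable fun u : ℝ => Real.exp (-((u - c) ^ 2 / (2 * γ))) * f u := by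
  refine (integrable_pow_mul_of_le_decayEnvelope hf hK c 0).norm.mono' (by fun_prop)
    (ae_of_all _ fun u => ?_)
  rw [norm_mul, Real.norm_of_nonneg (Real.exp_pos _).le, pow_zero, one_mul]
  refine mul_le_of_le_one_left (norm_nonneg _) ?_
  rw [Real.exp_le_one_iff]
  have : 0 ≤ (u - c) ^ 2 / (2 * γ) := by positivity
  linarith

lemma integrable_exp_mul_entropyKernel (c : ℝ) {γ : ℝ} (hγ : 0 < γ) :
    Integrable fun u : ℝ => Real.exp (-((u - c) ^ 2 / (2 * γ))) * entropyKernel u :=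
  integrable_exp_mul_of_le_decayEnvelope continuous_entropyKernel abs_entropyKernel_le c hγ

lemma alternating_entropyIntegral_sub_sum_nonneg (c : ℝ) {γ : ℝ} (hγ : 0 < γ) (N : ℕ) :
    0 ≤ (-1) ^ N * (entropyIntegral c γ -
      ∑ n ∈ Finset.range N, (-1) ^ n * kernelMoment c (2 * n) / ((2 * γ) ^ n * n !)) := by
  have hterm (n : ℕ) (u : ℝ) : (-((u - c) ^ 2 / (2 * γ))) ^ n / n ! * entropyKernel u =
      (-1) ^ n / ((2 * γ) ^ n * n !) * ((u - c) ^ (2 * n) * entropyKernel u) := by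
    rw [neg_pow, div_pow, ← pow_mul]
    field_simp
  have hint (n : ℕ) : Integrable fun u : ℝ =>
      (-((u - c) ^ 2 / (2 * γ))) ^ n / n ! * entropyKernel u := by
    simp only [hterm]
    exact (integrable_pow_mul_entropyKernel c (2 * n)).const_mul _
  have h : (-1) ^ N * (entropyIntegral c γ -
      ∑ n ∈ Finset.range N, (-1) ^ n * kernelMoment c (2 * n) / ((2 * γ) ^ n * n !)) =
      ∫ u : ℝ, (-1) ^ N * (Real.exp (-((u - c) ^ 2 / (2 * γ))) -
        ∑ n ∈ Finset.range N, (-((u - c) ^ 2 / (2 * γ))) ^ n / n !) * entropyKernel u := by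
    simp only [mul_assoc, sub_mul, Finset.sum_mul]
    rw [integral_const_mul, integral_sub (integrable_exp_mul_entropyKernel c hγ)
      (integrable_finsetSum _ fun n _ => hint n), integral_finsetSum _ fun n _ => hint n]
    congr 2
    refine Finset.sum_congr rfl fun n _ => ?_
    simp only [hterm]
    rw [integral_const_mul, kernelMoment]
    ring
  rw [h]
  exact integral_nonneg fun u => mul_nonneg
    (alternating_exp_neg_sub_sum_nonneg N (by positivity)) (entropyKernel_nonneg u)

/-! ### Laws and densities of the channel -/

lemma withDensity_map_of_measurable {S T : Type*} [MeasurableSpace S] [MeasurableSpace T]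
    (ν : Measure S) {e : S → T} (he : Measurable e) {F : T → ℝ≥0∞} (hF : Measurable F) :
    (ν.map e).withDensity F = (ν.withDensity (F ∘ e)).map e := by
  ext s hs
  rw [withDensity_apply _ hs, Measure.map_apply he hs, withDensity_apply _ (he hs),
    Measure.restrict_map he hs, lintegral_map hF he]
  rfl

/-- The law of a variable equal to `-1` with probability `α` and to `1` otherwise. -/
def binaryLaw (α : ℝ) : Measure ℝ :=
  ENNReal.ofReal α • Measure.dirac (-1) + ENNReal.ofReal (1 - α) • Measure.dirac 1

lemma map_eq_binaryLaw {Ω : Type*} [MeasurableSpace Ω] {μ : Measure Ω} [IsProbabilityMeasure μ]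
    {α : ℝ} {X : Ω → ℝ} (hX : Measurable X) (hXneg : μ.real {ω | X ω = -1} = α)
    (hXpos : μ.real {ω | X ω = 1} = 1 - α) : μ.map X = binaryLaw α := by
  have : IsProbabilityMeasure (μ.map X) := Measure.isProbabilityMeasure_map hX.aemeasurable
  have h1 : (μ.map X).real {-1} = α := by
    rw [map_measureReal_apply hX (measurableSet_singleton _)]; exact hXneg
  have h2 : (μ.map X).real {1} = 1 - α := by
    rw [map_measureReal_apply hX (measurableSet_singleton _)]; exact hXpos
  have hdisj : Disjoint ({-1} : Set ℝ) {1} := by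
    rw [Set.disjoint_singleton]; norm_num
  have hms : MeasurableSet ({-1} ∪ {1} : Set ℝ) :=
    (measurableSet_singleton _).union (measurableSet_singleton _)
  have h3 : (μ.map X).real ({-1} ∪ {1})ᶜ = 0 := by
    rw [probReal_compl_eq_one_sub hms, measureReal_union hdisj (measurableSet_singleton _), h1, h2]
    ring
  have h4 : (μ.map X).restrict ({-1} ∪ {1}) = μ.map X := by
    refine Measure.restrict_eq_self_of_ae_mem ?_
    rw [measureReal_eq_zero_iff] at h3
    exact mem_ae_iff.2 h3
  rw [← h4, Measure.restrict_union hdisj (measurableSet_singleton _), Measure.restrict_singleton,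
    Measure.restrict_singleton, binaryLaw, ← ofReal_measureReal, ← ofReal_measureReal, h1, h2]

/-- The density of the channel output with amplitude `s`. -/
def outputDensity (α s y : ℝ) : ℝ :=
  α * gaussianPDFReal (-s) 1 y + (1 - α) * gaussianPDFReal s 1 y

/-- The density of the joint law of input and output with respect to the product of the marginal
laws. -/
def jointDensity (α s : ℝ) (z : ℝ × ℝ) : ℝ :=
  gaussianPDFReal (s * z.1) 1 z.2 / outputDensity α s z.2

/-- The law of the channel output with amplitude `s`. -/
def outputLaw (α s : ℝ) : Measure ℝ :=
  ENNReal.ofReal α • gaussianReal (-s) 1 + ENNReal.ofReal (1 - α) • gaussianReal s 1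

/-- The joint law of input and output with amplitude `s`. -/
def jointLaw (α s : ℝ) : Measure (ℝ × ℝ) :=
  ENNReal.ofReal α • (gaussianReal (-s) 1).map (Prod.mk (-1)) +
    ENNReal.ofReal (1 - α) • (gaussianReal s 1).map (Prod.mk 1)

lemma outputDensity_pos {α : ℝ} (hα0 : 0 < α) (hα1 : α < 1) (s y : ℝ) :
    0 < outputDensity α s y :=
  add_pos (mul_pos hα0 (gaussianPDFReal_pos _ _ _ one_ne_zero))
    (mul_pos (sub_pos.2 hα1) (gaussianPDFReal_pos _ _ _ one_ne_zero))

lemma measurable_outputDensity (α s : ℝ) : Measurable (outputDensity α s) :=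
  ((measurable_gaussianPDFReal _ _).const_mul _).add
    ((measurable_gaussianPDFReal _ _).const_mul _)

lemma measurable_jointDensity (α s : ℝ) : Measurable (jointDensity α s) := by
  refine Measurable.div ?_ ((measurable_outputDensity α s).comp measurable_snd)
  unfold gaussianPDFReal
  fun_prop

lemma outputLaw_eq_withDensity {α : ℝ} (hα0 : 0 < α) (hα1 : α < 1) (s : ℝ) :
    outputLaw α s = volume.withDensity fun y => ENNReal.ofReal (outputDensity α s y) := by
  rw [outputLaw, gaussianReal_of_var_ne_zero _ one_ne_zero,
    gaussianReal_of_var_ne_zero _ one_ne_zero,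
    ← withDensity_smul _ (measurable_gaussianPDF _ _),
    ← withDensity_smul _ (measurable_gaussianPDF _ _),
    ← withDensity_add_left ((measurable_gaussianPDF _ _).const_smul _)]
  congr 1
  ext y
  have h1 := gaussianPDFReal_nonneg (-s) 1 y
  have h2 := gaussianPDFReal_nonneg s 1 y
  have h3 : 0 ≤ 1 - α := by linarith
  simp only [Pi.add_apply, Pi.smul_apply, smul_eq_mul, gaussianPDF, outputDensity]
  rw [← ENNReal.ofReal_mul hα0.le, ← ENNReal.ofReal_mul h3,
    ← ENNReal.ofReal_add (by positivity) (by positivity)]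

/-- On the slice with input `x` the denominator of `jointDensity` cancels the output density. Gluing
the two slices identifies the joint law. -/
lemma outputLaw_withDensity {α : ℝ} (hα0 : 0 < α) (hα1 : α < 1) (s x : ℝ) :
    (outputLaw α s).withDensity ((fun z => ENNReal.ofReal (jointDensity α s z)) ∘ Prod.mk x) =
      gaussianReal (s * x) 1 := by
  rw [outputLaw_eq_withDensity hα0 hα1, ← withDensity_mul _
    (measurable_outputDensity α s).ennreal_ofReal
    ((measurable_jointDensity α s).ennreal_ofReal.comp measurable_prodMk_left),
    gaussianReal_of_var_ne_zero _ one_ne_zero]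
  congr 1
  ext y
  have h := outputDensity_pos hα0 hα1 s y
  simp only [Pi.mul_apply, Function.comp_apply, jointDensity, gaussianPDF]
  rw [← ENNReal.ofReal_mul h.le, mul_div_cancel₀ _ h.ne']

instance (α s : ℝ) : IsFiniteMeasure (outputLaw α s) := by
  unfold outputLaw
  have := Measure.smul_finite (gaussianReal (-s) 1) (ENNReal.ofReal_ne_top (r := α))
  have := Measure.smul_finite (gaussianReal s 1) (ENNReal.ofReal_ne_top (r := 1 - α))
  infer_instance

instance (α : ℝ) : IsFiniteMeasure (binaryLaw α) := by
  unfold binaryLaw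
  have := Measure.smul_finite (Measure.dirac (-1 : ℝ)) (ENNReal.ofReal_ne_top (r := α))
  have := Measure.smul_finite (Measure.dirac (1 : ℝ)) (ENNReal.ofReal_ne_top (r := 1 - α))
  infer_instance

lemma binaryLaw_prod (α : ℝ) (ν : Measure ℝ) [SFinite ν] : (binaryLaw α).prod ν =
    ENNReal.ofReal α • ν.map (Prod.mk (-1)) + ENNReal.ofReal (1 - α) • ν.map (Prod.mk 1) := by
  rw [binaryLaw, Measure.add_prod, Measure.prod_smul_left, Measure.prod_smul_left,
    Measure.dirac_prod, Measure.dirac_prod]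

lemma jointLaw_eq_withDensity {α : ℝ} (hα0 : 0 < α) (hα1 : α < 1) (s : ℝ) :
    jointLaw α s = ((binaryLaw α).prod (outputLaw α s)).withDensity
      fun z => ENNReal.ofReal (jointDensity α s z) := by
  have hF := (measurable_jointDensity α s).ennreal_ofReal
  rw [binaryLaw_prod, withDensity_add_measure, withDensity_smul_measure, withDensity_smul_measure,
    withDensity_map_of_measurable _ measurable_prodMk_left hF,
    withDensity_map_of_measurable _ measurable_prodMk_left hF,
    outputLaw_withDensity hα0 hα1, outputLaw_withDensity hα0 hα1, jointLaw, mul_neg, mul_one]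

lemma llr_jointLaw {α : ℝ} (hα0 : 0 < α) (hα1 : α < 1) (s : ℝ) :
    llr (jointLaw α s) ((binaryLaw α).prod (outputLaw α s)) =ᵐ[jointLaw α s]
      fun z => Real.log (jointDensity α s z) := by
  have hF := (measurable_jointDensity α s).ennreal_ofReal
  have h := Measure.rnDeriv_withDensity ((binaryLaw α).prod (outputLaw α s)) hF
  rw [← jointLaw_eq_withDensity hα0 hα1] at h
  have hac : jointLaw α s ≪ (binaryLaw α).prod (outputLaw α s) := by
    rw [jointLaw_eq_withDensity hα0 hα1]
    exact withDensity_absolutelyContinuous _ _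
  filter_upwards [hac.ae_le h] with z hz
  rw [llr, hz, ENNReal.toReal_ofReal]
  exact div_nonneg (gaussianPDFReal_nonneg _ _ _) (outputDensity_pos hα0 hα1 _ _).le

section Channel

variable {Ω : Type*} [MeasurableSpace Ω] {μ : Measure Ω} [IsProbabilityMeasure μ]
  {α : ℝ} {X Z : Ω → ℝ}

lemma map_input_output (hX : Measurable X) (hXneg : μ.real {ω | X ω = -1} = α)
    (hXpos : μ.real {ω | X ω = 1} = 1 - α) (hZ : Measurable Z)
    (hZlaw : μ.map Z = gaussianReal 0 1) (hXZ : IndepFun X Z μ) (γ : ℝ) :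
    μ.map (fun ω => (X ω, channelOutput X Z γ ω)) = jointLaw α √γ := by
  have h := hXZ.map_prod_eq_prod_map_map hX.aemeasurable hZ.aemeasurable
  rw [map_eq_binaryLaw hX hXneg hXpos, hZlaw, binaryLaw_prod] at h
  have hm : Measurable fun z : ℝ × ℝ => (z.1, √γ * z.1 + z.2) := by fun_prop
  have hc : (fun ω => (X ω, channelOutput X Z γ ω)) =
      (fun z : ℝ × ℝ => (z.1, √γ * z.1 + z.2)) ∘ fun ω => (X ω, Z ω) := rfl
  have hx (x : ℝ) : ((gaussianReal 0 1).map (Prod.mk x)).map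
      (fun z : ℝ × ℝ => (z.1, √γ * z.1 + z.2)) = (gaussianReal (√γ * x) 1).map (Prod.mk x) := by
    have := gaussianReal_map_const_add (μ := 0) (v := 1) (√γ * x)
    rw [zero_add] at this
    rw [← this, Measure.map_map hm measurable_prodMk_left,
      Measure.map_map measurable_prodMk_left (by fun_prop)]
    rfl
  rw [hc, ← Measure.map_map hm (hX.prodMk hZ), h, Measure.map_add _ _ hm, Measure.map_smul,
    Measure.map_smul, hx, hx, jointLaw, mul_neg, mul_one]

lemma map_output (hX : Measurable X) (hXneg : μ.real {ω | X ω = -1} = α)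
    (hXpos : μ.real {ω | X ω = 1} = 1 - α) (hZ : Measurable Z)
    (hZlaw : μ.map Z = gaussianReal 0 1) (hXZ : IndepFun X Z μ) (γ : ℝ) :
    μ.map (channelOutput X Z γ) = outputLaw α √γ := by
  have h := congrArg (Measure.map Prod.snd)
    (map_input_output hX hXneg hXpos hZ hZlaw hXZ γ)
  have hY : Measurable (channelOutput X Z γ) := (hX.const_mul _).add hZ
  have hx (m x : ℝ) : ((gaussianReal m 1).map (Prod.mk x)).map (Prod.snd : ℝ × ℝ → ℝ) =
      gaussianReal m 1 := by
    rw [Measure.map_map measurable_snd measurable_prodMk_left]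
    exact Measure.map_id
  rw [Measure.map_map measurable_snd (hX.prodMk hY), jointLaw, Measure.map_add _ _ measurable_snd,
    Measure.map_smul, Measure.map_smul, hx, hx] at h
  exact h

lemma mutualInfoNats_eq_klDiv (hX : Measurable X) (hXneg : μ.real {ω | X ω = -1} = α)
    (hXpos : μ.real {ω | X ω = 1} = 1 - α) (hZ : Measurable Z)
    (hZlaw : μ.map Z = gaussianReal 0 1) (hXZ : IndepFun X Z μ) (γ : ℝ) :
    mutualInfoNats μ X (channelOutput X Z γ) =
      InformationTheory.klDiv (jointLaw α √γ) ((binaryLaw α).prod (outputLaw α √γ)) := by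
  rw [mutualInfoNats, map_input_output hX hXneg hXpos hZ hZlaw hXZ,
    map_output hX hXneg hXpos hZ hZlaw hXZ, map_eq_binaryLaw hX hXneg hXpos]

end Channel

/-! ### Mutual information as an integral of the entropy kernel -/

/-- For `u = m y + log (p/r)/2`, `exp (-2u)` is the ratio of the two mixture terms, so the
log-density is `-log p - log (1 + exp (-2u))`. The prefactor becomes symmetric in `p, r` through
`√(p r) e^u = p e^(m y)`. Leaving the sign of `m` free covers both inputs. -/
lemma mul_gaussianPDFReal_mul_log {p r : ℝ} (hp : 0 < p) (hr : 0 < r) (m y : ℝ) :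
    p * (gaussianPDFReal m 1 y * Real.log (gaussianPDFReal m 1 y /
      (p * gaussianPDFReal m 1 y + r * gaussianPDFReal (-m) 1 y))) =
    -(p * Real.log p) * gaussianPDFReal m 1 y -
      √(p * r) / √(2 * Real.pi) * Real.exp (-m ^ 2 / 2) *
        (Real.exp (-(y ^ 2 / 2)) * expMulLog (m * y + Real.log (p / r) / 2)) := by
  set u := m * y + Real.log (p / r) / 2 with hu
  have hA : gaussianPDFReal m 1 y = (√(2 * Real.pi))⁻¹ * Real.exp (-m ^ 2 / 2) *
      Real.exp (-(y ^ 2 / 2)) * Real.exp (m * y) := by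
    have e : Real.exp (-(y - m) ^ 2 / 2) =
        Real.exp (-m ^ 2 / 2) * Real.exp (-(y ^ 2 / 2)) * Real.exp (m * y) := by
      rw [← Real.exp_add, ← Real.exp_add]; congr 1; ring
    simp only [gaussianPDFReal, NNReal.coe_one, mul_one, e, mul_assoc]
  have hB : gaussianPDFReal (-m) 1 y = gaussianPDFReal m 1 y * Real.exp (-2 * (m * y)) := by
    have e : Real.exp (-(y - -m) ^ 2 / 2) =
        Real.exp (-(y - m) ^ 2 / 2) * Real.exp (-2 * (m * y)) := by
      rw [← Real.exp_add]; congr 1; ring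
    simp only [gaussianPDFReal, NNReal.coe_one, mul_one, e, mul_assoc]
  have hApos := gaussianPDFReal_pos m 1 y one_ne_zero
  have e1 : Real.exp (-2 * u) = r / p * Real.exp (-2 * (m * y)) := by
    rw [hu, show -2 * (m * y + Real.log (p / r) / 2) = -Real.log (p / r) + -2 * (m * y) by ring,
      Real.exp_add, Real.exp_neg, Real.exp_log (by positivity), inv_div]
  have e2 : √(p * r) * Real.exp u = p * Real.exp (m * y) := by
    rw [hu, Real.exp_add, Real.exp_half, Real.exp_log (by positivity)]
    have : √(p * r) * √(p / r) = p := by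
      rw [← Real.sqrt_mul (by positivity), show p * r * (p / r) = p * p by field_simp,
        Real.sqrt_mul_self hp.le]
    linear_combination Real.exp (m * y) * this
  have e3 : gaussianPDFReal m 1 y /
      (p * gaussianPDFReal m 1 y + r * gaussianPDFReal (-m) 1 y) =
      (p * (1 + Real.exp (-2 * u)))⁻¹ := by
    rw [e1, hB]
    have := Real.exp_pos (-2 * (m * y))
    field_simp
  rw [e3, Real.log_inv, Real.log_mul hp.ne' (by positivity), expMulLog, hA]
  linear_combination ((√(2 * Real.pi))⁻¹ * Real.exp (-m ^ 2 / 2) * Real.exp (-(y ^ 2 / 2)) *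
    Real.log (1 + Real.exp (-2 * u))) * e2

lemma integrable_exp_neg_sq_mul_comp {f : ℝ → ℝ} {K : ℝ} (hf : Continuous f)
    (hK : ∀ u, |f u| ≤ K * decayEnvelope u) {m : ℝ} (hm : m ≠ 0) (c : ℝ) :
    Integrable fun y : ℝ => Real.exp (-(y ^ 2 / 2)) * f (m * y + c) := by
  have h := ((integrable_exp_mul_of_le_decayEnvelope hf hK c
    (show 0 < m ^ 2 by positivity)).comp_add_right c).comp_mul_left' hm
  refine h.congr (ae_of_all _ fun y => ?_)
  simp only [add_sub_cancel_right]
  congr 3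
  field_simp

lemma integral_exp_neg_sq_mul_comp (f : ℝ → ℝ) {m : ℝ} (hm : m ≠ 0) (c : ℝ) :
    ∫ y : ℝ, Real.exp (-(y ^ 2 / 2)) * f (m * y + c) =
      |m|⁻¹ * ∫ u : ℝ, Real.exp (-((u - c) ^ 2 / (2 * m ^ 2))) * f u := by
  have h1 := Measure.integral_comp_mul_left
    (fun x : ℝ => Real.exp (-((x + c - c) ^ 2 / (2 * m ^ 2))) * f (x + c)) m
  rw [integral_add_right_eq_self (fun u : ℝ => Real.exp (-((u - c) ^ 2 / (2 * m ^ 2))) * f u) c,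
    smul_eq_mul, abs_inv] at h1
  rw [← h1]
  congr 1
  ext y
  congr 3
  rw [add_sub_cancel_right]
  field_simp

lemma integrable_and_integral_log_gaussian {p r : ℝ} (hp : 0 < p) (hr : 0 < r) {m : ℝ}
    (hm : m ≠ 0) :
    Integrable (fun y => Real.log (gaussianPDFReal m 1 y /
      (p * gaussianPDFReal m 1 y + r * gaussianPDFReal (-m) 1 y))) (gaussianReal m 1) ∧
    p * ∫ y, Real.log (gaussianPDFReal m 1 y /
      (p * gaussianPDFReal m 1 y + r * gaussianPDFReal (-m) 1 y)) ∂gaussianReal m 1 =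
      -(p * Real.log p) - √(p * r) / √(2 * Real.pi) * Real.exp (-m ^ 2 / 2) *
        ∫ y : ℝ, Real.exp (-(y ^ 2 / 2)) * expMulLog (m * y + Real.log (p / r) / 2) := by
  have h1 : Integrable fun y => -(p * Real.log p) * gaussianPDFReal m 1 y :=
    (integrable_gaussianPDFReal m 1).const_mul _
  have h2 : Integrable fun y : ℝ => √(p * r) / √(2 * Real.pi) * Real.exp (-m ^ 2 / 2) *
      (Real.exp (-(y ^ 2 / 2)) * expMulLog (m * y + Real.log (p / r) / 2)) :=
    (integrable_exp_neg_sq_mul_comp continuous_expMulLog (K := 3) (fun u => by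
      rw [abs_of_nonneg (expMulLog_nonneg u)]; exact expMulLog_le u) hm _).const_mul _
  have hpt (y : ℝ) := mul_gaussianPDFReal_mul_log hp hr m y
  constructor
  · rw [gaussianReal_of_var_ne_zero _ one_ne_zero, integrable_withDensity_iff_integrable_smul'
      (measurable_gaussianPDF _ _) (ae_of_all _ fun _ => gaussianPDF_lt_top)]
    refine ((h1.sub h2).const_mul p⁻¹).congr (ae_of_all _ fun y => ?_)
    simp only [Pi.sub_apply, toReal_gaussianPDF, smul_eq_mul]
    rw [← hpt, inv_mul_cancel_left₀ hp.ne']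
  · rw [integral_gaussianReal_eq_integral_smul one_ne_zero, ← integral_const_mul]
    simp only [smul_eq_mul, hpt]
    rw [integral_sub h1 h2, integral_const_mul, integral_const_mul,
      integral_gaussianPDFReal_eq_one _ one_ne_zero, mul_one]

lemma integrable_and_integral_log_jointDensity {α : ℝ} (hα0 : 0 < α) (hα1 : α < 1) {γ : ℝ}
    (hγ : 0 < γ) :
    Integrable (fun z => Real.log (jointDensity α √γ z)) (jointLaw α √γ) ∧
    ∫ z, Real.log (jointDensity α √γ z) ∂jointLaw α √γ =
      -(α * Real.log α) - (1 - α) * Real.log (1 - α) -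
        √(α * (1 - α)) / √(2 * Real.pi) * Real.exp (-γ / 2) *
          ((√γ)⁻¹ * entropyIntegral (Real.log ((1 - α) / α) / 2) γ) := by
  have hβ : 0 < 1 - α := sub_pos.2 hα1
  set s := √γ with hs
  have hs0 : 0 < s := Real.sqrt_pos.2 hγ
  have hs2 : s ^ 2 = γ := Real.sq_sqrt hγ.le
  set c := Real.log ((1 - α) / α) / 2 with hc
  have hc' : Real.log (α / (1 - α)) / 2 = -c := by
    rw [hc, ← inv_div α (1 - α), Real.log_inv]; ring
  obtain ⟨i1, j1⟩ := integrable_and_integral_log_gaussian hα0 hβ (neg_ne_zero.2 hs0.ne')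
  obtain ⟨i2, j2⟩ := integrable_and_integral_log_gaussian hβ hα0 hs0.ne'
  have d1 : (fun z => Real.log (jointDensity α s z)) ∘ Prod.mk (-1) =
      fun y => Real.log (gaussianPDFReal (-s) 1 y /
        (α * gaussianPDFReal (-s) 1 y + (1 - α) * gaussianPDFReal (- -s) 1 y)) := by
    ext y
    simp [jointDensity, outputDensity]
  have d2 : (fun z => Real.log (jointDensity α s z)) ∘ Prod.mk 1 =
      fun y => Real.log (gaussianPDFReal s 1 y /
        ((1 - α) * gaussianPDFReal s 1 y + α * gaussianPDFReal (-s) 1 y)) := by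
    ext y
    simp [jointDensity, outputDensity, add_comm]
  have hmeas : Measurable fun z => Real.log (jointDensity α s z) :=
    (measurable_jointDensity α s).log
  have k1 : Integrable (fun z => Real.log (jointDensity α s z))
      ((gaussianReal (-s) 1).map (Prod.mk (-1))) := by
    rw [integrable_map_measure hmeas.aestronglyMeasurable measurable_prodMk_left.aemeasurable, d1]
    exact i1
  have k2 : Integrable (fun z => Real.log (jointDensity α s z))
      ((gaussianReal s 1).map (Prod.mk 1)) := by
    rw [integrable_map_measure hmeas.aestronglyMeasurable measurable_prodMk_left.aemeasurable, d2]
    exact i2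
  have l1 := k1.smul_measure (ENNReal.ofReal_ne_top (r := α))
  have l2 := k2.smul_measure (ENNReal.ofReal_ne_top (r := 1 - α))
  refine ⟨l1.add_measure l2, ?_⟩
  rw [jointLaw, integral_add_measure l1 l2, integral_smul_measure, integral_smul_measure,
    integral_map measurable_prodMk_left.aemeasurable hmeas.aestronglyMeasurable,
    integral_map measurable_prodMk_left.aemeasurable hmeas.aestronglyMeasurable,
    ENNReal.toReal_ofReal hα0.le, ENNReal.toReal_ofReal hβ.le, smul_eq_mul, smul_eq_mul]
  have d1' (y : ℝ) := congrFun d1 y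
  have d2' (y : ℝ) := congrFun d2 y
  simp only [Function.comp_apply] at d1' d2'
  simp only [d1', d2']
  have hK (u : ℝ) : |expMulLog u| ≤ 3 * decayEnvelope u := by
    rw [abs_of_nonneg (expMulLog_nonneg u)]; exact expMulLog_le u
  have hK' (u : ℝ) : |expMulLog (-u)| ≤ 3 * decayEnvelope u := by
    rw [← decayEnvelope_neg]; exact hK _
  -- The two inputs give opposite arguments `∓(s y + c)`, so their contributions add up to the
  -- symmetric kernel.
  have hsum : (∫ y : ℝ, Real.exp (-(y ^ 2 / 2)) * expMulLog (-s * y + -c)) +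
      ∫ y : ℝ, Real.exp (-(y ^ 2 / 2)) * expMulLog (s * y + c) = s⁻¹ * entropyIntegral c γ := by
    have e := integral_exp_neg_sq_mul_comp entropyKernel hs0.ne' c
    rw [abs_of_pos hs0, hs2] at e
    rw [entropyIntegral, ← e, ← integral_add]
    · congr 1; ext y
      rw [entropyKernel, show -s * y + -c = -(s * y + c) by ring]; ring
    · have := integrable_exp_neg_sq_mul_comp
        (continuous_expMulLog.comp continuous_neg) hK' hs0.ne' c
      refine this.congr (ae_of_all _ fun y => ?_)
      simp only [Function.comp_apply]
      rw [show -s * y + -c = -(s * y + c) by ring]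
    · exact integrable_exp_neg_sq_mul_comp continuous_expMulLog hK hs0.ne' c
  rw [j1, j2, hc', ← hsum, mul_comm (1 - α) α, neg_sq, hs2]
  ring

section Channel

variable {Ω : Type*} [MeasurableSpace Ω] {μ : Measure Ω} [IsProbabilityMeasure μ]
  {α : ℝ} {X Z : Ω → ℝ}

lemma mutualInfoNats_ne_top_and_toReal (hα0 : 0 < α) (hα1 : α < 1) (hX : Measurable X)
    (hXneg : μ.real {ω | X ω = -1} = α) (hXpos : μ.real {ω | X ω = 1} = 1 - α)
    (hZ : Measurable Z) (hZlaw : μ.map Z = gaussianReal 0 1) (hXZ : IndepFun X Z μ) {γ : ℝ}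
    (hγ : 0 < γ) :
    mutualInfoNats μ X (channelOutput X Z γ) ≠ ∞ ∧
    (mutualInfoNats μ X (channelOutput X Z γ)).toReal =
      -(α * Real.log α) - (1 - α) * Real.log (1 - α) -
        √(α * (1 - α)) / √(2 * Real.pi) * Real.exp (-γ / 2) *
          ((√γ)⁻¹ * entropyIntegral (Real.log ((1 - α) / α) / 2) γ) := by
  obtain ⟨hi, he⟩ := integrable_and_integral_log_jointDensity hα0 hα1 hγ
  have hllr := llr_jointLaw hα0 hα1 √γ
  have hac : jointLaw α √γ ≪ (binaryLaw α).prod (outputLaw α √γ) := by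
    rw [jointLaw_eq_withDensity hα0 hα1]
    exact withDensity_absolutelyContinuous _ _
  have hY : Measurable (channelOutput X Z γ) := (hX.const_mul _).add hZ
  have : IsProbabilityMeasure (jointLaw α √γ) := by
    rw [← map_input_output hX hXneg hXpos hZ hZlaw hXZ]
    exact Measure.isProbabilityMeasure_map (hX.prodMk hY).aemeasurable
  have : IsProbabilityMeasure (binaryLaw α) := by
    rw [← map_eq_binaryLaw hX hXneg hXpos]
    exact Measure.isProbabilityMeasure_map hX.aemeasurable
  have : IsProbabilityMeasure (outputLaw α √γ) := by
    rw [← map_output hX hXneg hXpos hZ hZlaw hXZ]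
    exact Measure.isProbabilityMeasure_map hY.aemeasurable
  rw [mutualInfoNats_eq_klDiv hX hXneg hXpos hZ hZlaw hXZ]
  refine ⟨InformationTheory.klDiv_ne_top hac ((integrable_congr hllr).2 hi), ?_⟩
  -- Both measures have mass one, so the mass correction in `klDiv` vanishes.
  rw [InformationTheory.toReal_klDiv_of_measure_eq hac (by simp), integral_congr_ae hllr, he]

/-! ### Coefficients, bounds and asymptotics -/

/-- The factor `8^n` is `4^n` from the kernel moments times `2^n` from the Gaussian exponent.
Replacing `log ((1-α)/α)` by its negative is harmless since only even powers occur. -/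
lemma miCoeff_eq (hα0 : 0 < α) (hα1 : α < 1) (n : ℕ) :
    miCoeff n α = √(α * (1 - α)) / √(2 * Real.pi) / Real.log 2 *
      (kernelMoment (Real.log ((1 - α) / α) / 2) (2 * n) / (2 ^ n * n !)) := by
  have hL : Real.log ((1 - α) / α) = -Real.log (α / (1 - α)) := by
    rw [← inv_div, Real.log_inv]
  have hpi := Real.pi_pos
  have h2pi : √(2 * Real.pi) ^ 2 = 2 * Real.pi := Real.sq_sqrt (by positivity)
  have hsq : √2 * √(Real.pi * α * (1 - α)) = √(α * (1 - α)) * √(2 * Real.pi) := by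
    rw [← Real.sqrt_mul (by norm_num), ← Real.sqrt_mul (mul_nonneg hα0.le (sub_nonneg.2 hα1.le))]
    congr 1; ring
  have hlog : 0 < Real.log 2 := Real.log_pos (by norm_num)
  have h8 : (8 : ℝ) ^ n = 4 ^ n * 2 ^ n := by rw [← mul_pow]; norm_num
  have hn : (n ! : ℝ) ≠ 0 := by exact_mod_cast Nat.factorial_ne_zero _
  have h2 : 0 < √(2 * Real.pi) := Real.sqrt_pos.2 (by positivity)
  rw [hL, kernelMoment_half_even, miCoeff, hsq]
  simp only [Even.neg_pow (even_two_mul _)]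
  have h (S : ℝ) : √(α * (1 - α)) * √(2 * Real.pi) / (8 ^ n * n ! * Real.log 2) * S =
      √(α * (1 - α)) / √(2 * Real.pi) / Real.log 2 *
        (2 * Real.pi / 4 ^ n * S / (2 ^ n * n !)) := by
    rw [h8]
    field_simp
    rw [h2pi]
    ring
  exact h _

lemma alternating_mutualInfoBits_sub_miPartialSum_nonpos (hα0 : 0 < α) (hα1 : α < 1)
    (hX : Measurable X) (hXneg : μ.real {ω | X ω = -1} = α)
    (hXpos : μ.real {ω | X ω = 1} = 1 - α) (hZ : Measurable Z)
    (hZlaw : μ.map Z = gaussianReal 0 1) (hXZ : IndepFun X Z μ) {γ : ℝ} (hγ : 0 < γ) (N : ℕ) :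
    (-1) ^ N * (mutualInfoBits μ X (channelOutput X Z γ) - miPartialSum α γ N) ≤ 0 := by
  obtain ⟨-, he⟩ := mutualInfoNats_ne_top_and_toReal hα0 hα1 hX hXneg hXpos hZ hZlaw hXZ hγ
  have hlog : 0 < Real.log 2 := Real.log_pos (by norm_num)
  have hs : 0 < √γ := Real.sqrt_pos.2 hγ
  set c := Real.log ((1 - α) / α) / 2 with hc
  set B := √(α * (1 - α)) / √(2 * Real.pi) / Real.log 2 * (Real.exp (-γ / 2) * (√γ)⁻¹) with hB
  have hB0 : 0 ≤ B := by positivity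
  have h1 : mutualInfoBits μ X (channelOutput X Z γ) =
      binEntropyBits α - B * entropyIntegral c γ := by
    rw [mutualInfoBits, he, hB, binEntropyBits, Real.logb, Real.logb]
    field_simp
  have h2 : miPartialSum α γ N = binEntropyBits α - B *
      ∑ n ∈ Finset.range N, (-1) ^ n * kernelMoment c (2 * n) / ((2 * γ) ^ n * n !) := by
    rw [miPartialSum, Finset.mul_sum]
    congr 1
    refine Finset.sum_congr rfl fun n _ => ?_
    have hn : (n ! : ℝ) ≠ 0 := by exact_mod_cast Nat.factorial_ne_zero _
    rw [miCoeff_eq hα0 hα1, Real.rpow_add hγ, Real.rpow_natCast, ← Real.sqrt_eq_rpow, hB, mul_pow, ← hc]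
    field_simp
  rw [h1, h2]
  have := mul_nonneg hB0 (alternating_entropyIntegral_sub_sum_nonneg c hγ N)
  linarith

end Channel

lemma isLittleO_exp_div_rpow (K : ℝ) {a b : ℝ} (hab : a < b) :
    (fun γ : ℝ => K / γ ^ b * Real.exp (-γ / 2)) =o[atTop] fun γ => Real.exp (-γ / 2) / γ ^ a := by
  have h : (fun γ : ℝ => K * γ ^ (-(b - a))) =o[atTop] fun _ => (1 : ℝ) := by
    rw [isLittleO_one_iff]
    simpa using (tendsto_rpow_neg_atTop (sub_pos.2 hab)).const_mul K
  refine (h.mul_isBigO (isBigO_refl (fun γ : ℝ => Real.exp (-γ / 2) / γ ^ a) atTop)).congr' ?_ ?_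
  · filter_upwards [eventually_gt_atTop 0] with γ hγ
    rw [Real.rpow_neg hγ.le, Real.rpow_sub hγ]
    have := Real.rpow_pos_of_pos hγ a
    have := Real.rpow_pos_of_pos hγ b
    field_simp
  · filter_upwards with γ
    rw [one_mul]

end

theorem theorem2 {Ω : Type*} [MeasurableSpace Ω] (μ : Measure Ω) [IsProbabilityMeasure μ]
    (α : ℝ) (hα0 : 0 < α) (hα1 : α < 1) (X Z : Ω → ℝ) (hX : Measurable X)
    (hXneg : μ.real {ω | X ω = -1} = α) (hXpos : μ.real {ω | X ω = 1} = 1 - α)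
    (hZ : Measurable Z) (hZlaw : μ.map Z = gaussianReal 0 1) (hXZ : IndepFun X Z μ) :
    -- the mutual information is finite
    (∀ γ : ℝ, 0 < γ → mutualInfoNats μ X (channelOutput X Z γ) ≠ ∞) ∧
    -- asymptotic expansion as `γ → ∞`
    (∀ N : ℕ,
      (fun γ : ℝ => mutualInfoBits μ X (channelOutput X Z γ) - miPartialSum α γ (N + 1))
        =o[atTop] fun γ : ℝ => Real.exp (-γ / 2) / γ ^ ((N : ℝ) + 1 / 2)) ∧
    -- the partial sums are alternately lower and upper bounds
    (∀ γ : ℝ, 0 < γ → ∀ N : ℕ,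
      miPartialSum α γ (2 * N + 1) ≤ mutualInfoBits μ X (channelOutput X Z γ) ∧
      mutualInfoBits μ X (channelOutput X Z γ) ≤ miPartialSum α γ (2 * N)) := by
  have key {γ : ℝ} (hγ : 0 < γ) (N : ℕ) :=
    alternating_mutualInfoBits_sub_miPartialSum_nonpos hα0 hα1 hX hXneg hXpos hZ hZlaw hXZ hγ N
  refine ⟨fun γ hγ =>
    (mutualInfoNats_ne_top_and_toReal hα0 hα1 hX hXneg hXpos hZ hZlaw hXZ hγ).1,
    fun N => ?_, fun γ hγ N => ⟨?_, ?_⟩⟩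
  · have hlt : (N : ℝ) + 1 / 2 < ((N + 1 : ℕ) : ℝ) + 1 / 2 := by push_cast; linarith
    -- The mutual information lies between two consecutive partial sums, so the error is at most the
    -- first omitted term, which is smaller than the comparison function by a factor of order `1/γ`.
    refine (IsBigO.of_bound 1 ?_).trans_isLittleO (isLittleO_exp_div_rpow (miCoeff (N + 1) α) hlt)
    filter_upwards [eventually_gt_atTop 0] with γ hγ
    have h1 := key hγ (N + 1)
    have h2 := key hγ (N + 1 + 1)
    set I := mutualInfoBits μ X (channelOutput X Z γ)
    have h3 : miPartialSum α γ (N + 1 + 1) = miPartialSum α γ (N + 1) -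
        (-1) ^ (N + 1) * (miCoeff (N + 1) α / γ ^ (((N + 1 : ℕ) : ℝ) + 1 / 2) *
          Real.exp (-γ / 2)) := by
      simp only [miPartialSum, Finset.sum_range_succ _ (N + 1)]
      ring
    set T := miCoeff (N + 1) α / γ ^ (((N + 1 : ℕ) : ℝ) + 1 / 2) * Real.exp (-γ / 2)
    rw [h3, pow_succ _ (N + 1)] at h2
    rw [one_mul, Real.norm_eq_abs, Real.norm_eq_abs]
    rcases neg_one_pow_eq_or ℝ (N + 1) with e | e <;> rw [e] at h1 h2
    · rw [abs_of_nonpos (by linarith), abs_of_nonneg (by linarith)]; linarith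
    · rw [abs_of_nonneg (by linarith), abs_of_nonneg (by linarith)]; linarith
  · have := key hγ (2 * N + 1)
    rw [pow_succ, pow_mul] at this
    norm_num at this
    linarith
  · have := key hγ (2 * N)
    rw [pow_mul] at this
    norm_num at this
    linarith
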